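/- Let $n\ge 0$, let $\Phi\in C^2(\mathbb R^n,\mathbb R)$ satisfy $\int_{\mathbb R^n} e^{-\Phi}\,dx=1$, and put $d\mu=e^{-\Phi}dx$, $L^2(\mu)=L^2(\mathbb R^n,\mu,\mathbb C)$. Forms of degree $k=1,2$ with coefficients in $L^2(\mu)$ form the Hilbert space $L^2(\mu,\wedge^k\mathbb C^n)$, in which the coefficients with respect to the basis $dz^{j_1}\wedge\dots\wedge dz^{j_k}$, $j_1<\dots<j_k$, are orthogonal; $\langle f,g\rangle_\mu=\int f\overline g\,d\mu$ (summed over coefficients) denotes the scalar products. Let $d_0$ (on functions) and $d_1$ (on 1-forms) be the exterior differentials, taken in the distribution sense on their maximal domains in these spaces, so $D(d_0)=H^1(\mu)$, and let $d_0^*,d_1^*$ be their Hilbert space adjoints. Let $$A_0=d_0^*d_0,\qquad A_1=d_1^*d_1+d_0d_0^*,\quad D(A_1)=D(d_1^*d_1)\cap D(d_0d_0^*),$$ and let $X=\overline{R(d_0)}\subset L^2(\mu,\wedge^1\mathbb C^n)$. Let $\tilde V=D(d_1)\cap D(d_0^*)\cap X$, normed by $\|d_0^*v\|_\mu$, with (linear)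 dual $\tilde V'$. Let $\tilde{\mathcal A}_1\colon\tilde V\to\tilde V'$ be given by $(\tilde{\mathcal A}_1v)(w)=\int (d_0^*v)(d_0^*w)\,d\mu$, and for $g\in L^2(\mu)$ let $dg\in\tilde V'$ be given by $(dg)(w)=\int g\,(d_0^*w)\,d\mu$. **Theorem.** Suppose that $A_0$, as an unbounded operator in $L^2(\mu)$, has closed range $R(A_0)$. Then: 1. $\tilde V$ is a Hilbert space and $\tilde{\mathcal A}_1\colon\tilde V\to\tilde V'$ is an isomorphism. It extends $A_1|_X$: for $v\in\tilde V$ and $f\in X$, $\tilde{\mathcal A}_1v$ is the functional $w\mapsto\int\sum_j f_jw_j\,d\mu$ if and only if $v\in D(A_1)$ and $A_1v=f$. The map $d\colon L^2(\mu)\to\tilde V'$ extends $d_0$, that is, $(dg)(w)=\int\sum_j (d_0g)_jw_j\,d\mu$ for $g\in H^1(\mu)$, $w\in\tilde V$; and it is the distributional differential: for $g\in L^2(\mu)$ and every $\varphi\in C_0^\infty(\mathbb R^n,\wedge^1\mathbb C^n)$, the orthogonal projection $v$ of $e^{\Phi}\varphi$ onto $X$ is in $\tilde V$ and $(dg)(v)=-\sum_j\int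 g\,\partial_j\varphi_j\,dx$. If $g\in H^1(\mu)$, then $\tilde{\mathcal A}_1^{-1}dg$ is the unique $v\in D(A_1)\cap X$ with $A_1v=d_0g$. Accordingly, write $A_1^{-1}dg:=\tilde{\mathcal A}_1^{-1}dg\in\tilde V$ for all $g\in L^2(\mu)$. 2. With $\langle g\rangle=\int g\,d\mu$, for all $g_1,g_2\in L^2(\mu)$, $$\langle g_1-\langle g_1\rangle,\;g_2-\langle g_2\rangle\rangle_\mu=\langle A_1^{-1}\nabla g_1,\nabla g_2\rangle_\mu,$$ where the right side is read as the duality $(d\overline{g_2})(A_1^{-1}dg_1)$ between $\tilde V'$ and $\tilde V$; when $g_2\in H^1(\mu)$ it equals the scalar product $\langle A_1^{-1}dg_1,d_0g_2\rangle_\mu$ of 1-forms. 3. $L^2(\mu)=R(A_0)\oplus\mathbb C$ (orthogonal sum, $\mathbb C$ the constant functions), and for every $u\in L^2(\mu)$, $$Pu=d_0^*A_1^{-1}d\,u,$$ where $Pu=u-\int u\,d\mu$ is the orthogonal projection onto $L^2(\mu)\ominus\mathbb C$. -/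

import Mathlib

open MeasureTheory
open scoped ContDiff LinearPMap

noncomputable section

namespace WeightedComplex

/-- Euclidean space `ℝⁿ`. -/
abbrev E (n : ℕ) : Type := EuclideanSpace ℝ (Fin n)

/-- A real-valued `C²` potential `Φ` on `ℝⁿ`, normalised so that `∫ exp (-Φ) dx = 1`. -/
structure Potential (n : ℕ) where
  /-- the potential itself -/
  toFun : E n → ℝ
  contDiff : ContDiff ℝ 2 toFun
  integral_eq_one : ∫ x, Real.exp (-toFun x) = 1

variable {n : ℕ}

/-- The measure `dμ = exp (-Φ) dx`. -/
def Potential.gibbs (Φ : Potential n) : Measure (E n) :=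
  volume.withDensity fun x => ENNReal.ofReal (Real.exp (-Φ.toFun x))

theorem Potential.continuous_exp (Φ : Potential n) :
    Continuous fun x => Real.exp (-Φ.toFun x) :=
  Real.continuous_exp.comp Φ.contDiff.continuous.neg

instance (Φ : Potential n) : IsProbabilityMeasure Φ.gibbs := by
  refine ⟨?_⟩
  have hint : Integrable fun x => Real.exp (-Φ.toFun x) := by
    by_contra h
    have := Φ.integral_eq_one
    rw [integral_undef h] at this
    exact zero_ne_one this
  rw [Potential.gibbs, withDensity_apply _ MeasurableSet.univ, Measure.restrict_univ,
    ← ofReal_integral_eq_lintegral_ofReal hint (Filter.Eventually.of_forall fun x =>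
      (Real.exp_pos _).le), Φ.integral_eq_one, ENNReal.ofReal_one]

theorem Potential.volume_absolutelyContinuous (Φ : Potential n) :
    (volume : Measure (E n)) ≪ Φ.gibbs := by
  refine withDensity_absolutelyContinuous' ?_ ?_
  · exact (ENNReal.measurable_ofReal.comp Φ.continuous_exp.measurable).aemeasurable
  · exact Filter.Eventually.of_forall fun x => by
      simpa using Real.exp_pos _

theorem Potential.absolutelyContinuous_volume (Φ : Potential n) :
    Φ.gibbs ≪ (volume : Measure (E n)) :=
  withDensity_absolutelyContinuous _ _

/-! ### The spaces `L²(μ, ⋀ᵏ ℂⁿ)` for `k = 0, 1, 2` -/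

/-- Index set of the basis 2-forms `dz^j ∧ dz^k`, `j < k`. -/
abbrev Pairs (n : ℕ) : Type := {p : Fin n × Fin n // p.1 < p.2}

/-- `L²(μ)`, complex-valued. -/
abbrev H0 (Φ : Potential n) : Type := Lp ℂ 2 Φ.gibbs

/-- `L²(μ, ⋀¹ ℂⁿ)`: the form `∑ vⱼ dzʲ` is identified with the vector function `(vⱼ)`. -/
abbrev H1 (Φ : Potential n) : Type := Lp (EuclideanSpace ℂ (Fin n)) 2 Φ.gibbs

/-- `L²(μ, ⋀² ℂⁿ)`: the form `∑_{j<k} ω_{jk} dzʲ ∧ dzᵏ` is identified with `(ω_{jk})_{j<k}`. -/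
abbrev H2 (Φ : Potential n) : Type := Lp (EuclideanSpace ℂ (Pairs n)) 2 Φ.gibbs

/-- Elements of `L²(μ)` are locally integrable for Lebesgue measure. -/
theorem locallyIntegrable_of_Lp {F : Type*} [NormedAddCommGroup F] [NormedSpace ℝ F]
    (Φ : Potential n) (u : Lp F 2 Φ.gibbs) : LocallyIntegrable u volume := by
  have h1 : Integrable u Φ.gibbs := (Lp.memLp u).integrable (by norm_num)
  have h1' := (integrable_withDensity_iff_integrable_smul'
    (ENNReal.measurable_ofReal.comp Φ.continuous_exp.measurable)
    (Filter.Eventually.of_forall fun x => ENNReal.ofReal_lt_top)).1 h1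
  have h2 : Continuous fun x => Real.exp (Φ.toFun x) :=
    Real.continuous_exp.comp Φ.contDiff.continuous
  rw [locallyIntegrable_iff]
  intro K hK
  have h3 := IntegrableOn.continuousOn_smul h1'.integrableOn h2.continuousOn hK
  refine h3.congr_fun_ae (Filter.Eventually.of_forall fun x => ?_)
  simp only [Function.comp_apply]
  rw [ENNReal.toReal_ofReal (Real.exp_pos _).le, smul_smul, ← Real.exp_add]
  simp

/-! ### Differentials in the distribution sense -/

/-- `φ ∈ C₀^∞(ℝⁿ, F)`. -/
def IsTest {F : Type*} [NormedAddCommGroup F] [NormedSpace ℝ F] (φ : E n → F) : Prop :=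
  ContDiff ℝ ∞ φ ∧ HasCompactSupport φ

/-- The partial derivative `∂ⱼ φ` of a differentiable function. -/
def partialD (j : Fin n) (φ : E n → ℂ) (x : E n) : ℂ :=
  fderiv ℝ φ x (EuclideanSpace.single j 1)

/-- The distribution `∂ⱼ f`, for `f` locally integrable, evaluated at the test function `φ`. -/
def distD (f : E n → ℂ) (j : Fin n) (φ : E n → ℂ) : ℂ :=
  -∫ x, f x * partialD j φ x

theorem integrable_mul_test {f φ : E n → ℂ} (hf : LocallyIntegrable f volume) (hφ : IsTest φ) :
    Integrable fun x => f x * φ x :=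
  hf.integrable_smul_right_of_hasCompactSupport hφ.1.continuous hφ.2

theorem IsTest.partialD {φ : E n → ℂ} (hφ : IsTest φ) (j : Fin n) : IsTest (partialD j φ) :=
  ⟨(hφ.1.fderiv_right (m := ∞) le_rfl).clm_apply contDiff_const,
    (hφ.2.fderiv ℝ).comp_left (g := fun L : E n →L[ℝ] ℂ => L (EuclideanSpace.single j 1))
      (by simp)⟩

theorem locallyIntegrable_coord {ι : Type*} [Fintype ι] {Φ : Potential n}
    (v : Lp (EuclideanSpace ℂ ι) 2 Φ.gibbs) (j : ι) :
    LocallyIntegrable (fun x => v x j) volume := by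
  rw [locallyIntegrable_iff]
  intro K hK
  exact (EuclideanSpace.proj j : EuclideanSpace ℂ ι →L[ℂ] ℂ).integrable_comp
    ((locallyIntegrable_of_Lp Φ v).integrableOn_isCompact hK)

section Linearity

variable {Φ : Potential n} {φ : E n → ℂ}

theorem distD_congr {f g : E n → ℂ} (h : f =ᵐ[Φ.gibbs] g) (j : Fin n) (φ : E n → ℂ) :
    distD f j φ = distD g j φ := by
  unfold distD
  congr 1
  exact integral_congr_ae ((Φ.volume_absolutelyContinuous.ae_eq h).mono fun x hx => by
    simp only [hx])

theorem distD_add {f g : E n → ℂ} (hf : LocallyIntegrable f volume)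
    (hg : LocallyIntegrable g volume) (hφ : IsTest φ) (j : Fin n) :
    distD (fun x => f x + g x) j φ = distD f j φ + distD g j φ := by
  unfold distD
  simp only [add_mul]
  rw [integral_add (integrable_mul_test hf (hφ.partialD j))
    (integrable_mul_test hg (hφ.partialD j))]
  ring

theorem distD_smul (c : ℂ) (f : E n → ℂ) (j : Fin n) :
    distD (fun x => c * f x) j φ = c * distD f j φ := by
  unfold distD
  simp only [mul_assoc]
  rw [integral_const_mul]
  ring

theorem pair_congr {f g : E n → ℂ} (h : f =ᵐ[Φ.gibbs] g) (φ : E n → ℂ) :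
    ∫ x, f x * φ x = ∫ x, g x * φ x :=
  integral_congr_ae ((Φ.volume_absolutelyContinuous.ae_eq h).mono fun x hx => by
    simp only [hx])

theorem pair_add {f g : E n → ℂ} (hf : LocallyIntegrable f volume)
    (hg : LocallyIntegrable g volume) (hφ : IsTest φ) :
    ∫ x, (f x + g x) * φ x = (∫ x, f x * φ x) + ∫ x, g x * φ x := by
  simp only [add_mul]
  exact integral_add (integrable_mul_test hf hφ) (integrable_mul_test hg hφ)

theorem pair_smul (c : ℂ) (f : E n → ℂ) :
    ∫ x, (c * f x) * φ x = c * ∫ x, f x * φ x := by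
  simp only [mul_assoc]
  exact integral_const_mul _ _

theorem coord_add {ι : Type*} [Fintype ι] (v w : Lp (EuclideanSpace ℂ ι) 2 Φ.gibbs) (j : ι) :
    (fun x => (v + w : Lp (EuclideanSpace ℂ ι) 2 Φ.gibbs) x j) =ᵐ[Φ.gibbs]
      fun x => v x j + w x j :=
  (Lp.coeFn_add v w).mono fun _ hx => congrArg (fun z : EuclideanSpace ℂ ι => z j) hx

theorem coord_smul {ι : Type*} [Fintype ι] (c : ℂ) (v : Lp (EuclideanSpace ℂ ι) 2 Φ.gibbs)
    (j : ι) :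
    (fun x => (c • v : Lp (EuclideanSpace ℂ ι) 2 Φ.gibbs) x j) =ᵐ[Φ.gibbs]
      fun x => c * v x j :=
  (Lp.coeFn_smul c v).mono fun _ hx => congrArg (fun z : EuclideanSpace ℂ ι => z j) hx

theorem coord_zero {ι : Type*} [Fintype ι] (j : ι) :
    (fun x => (0 : Lp (EuclideanSpace ℂ ι) 2 Φ.gibbs) x j) =ᵐ[Φ.gibbs] fun _ => 0 :=
  (Lp.coeFn_zero (EuclideanSpace ℂ ι) 2 Φ.gibbs).mono fun _ hx =>
    congrArg (fun z : EuclideanSpace ℂ ι => z j) hx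

theorem eq_zero_of_pair_eq_zero {ι : Type*} [Fintype ι]
    (v : Lp (EuclideanSpace ℂ ι) 2 Φ.gibbs)
    (h : ∀ (j : ι) (φ : E n → ℂ), IsTest φ → ∫ x, v x j * φ x = 0) : v = 0 := by
  have key : ∀ j, ∀ᵐ x ∂(volume : Measure (E n)), v x j = 0 := by
    intro j
    refine ae_eq_zero_of_integral_contDiff_smul_eq_zero (locallyIntegrable_coord v j) ?_
    intro g hg hgs
    have := h j (fun x => (g x : ℂ)) ⟨Complex.ofRealCLM.contDiff.comp hg,
      hgs.comp_left (g := fun r : ℝ => (r : ℂ)) (by simp)⟩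
    rw [← this]
    exact integral_congr_ae (Filter.Eventually.of_forall fun x => by
      simp [mul_comm])
  rw [Lp.eq_zero_iff_ae_eq_zero]
  refine Φ.absolutelyContinuous_volume.ae_le ?_
  filter_upwards [ae_all_iff.2 key] with x hx
  ext j
  simpa using hx j

end Linearity

/-- The graph of `d₀`: pairs `(u, v)` with `vⱼ = ∂ⱼ u` in the distribution sense. -/
def graphD0 (Φ : Potential n) : Submodule ℂ (H0 Φ × H1 Φ) where
  carrier := {p | ∀ (j : Fin n) (φ : E n → ℂ), IsTest φ →
    ∫ x, p.2 x j * φ x = distD p.1 j φ}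
  add_mem' := by
    intro p q hp hq j φ hφ
    have hp' := hp j φ hφ
    have hq' := hq j φ hφ
    rw [Prod.fst_add, Prod.snd_add, pair_congr (coord_add p.2 q.2 j),
      distD_congr (Lp.coeFn_add p.1 q.1),
      pair_add (locallyIntegrable_coord _ _) (locallyIntegrable_coord _ _) hφ, hp', hq']
    exact (distD_add (locallyIntegrable_of_Lp Φ _) (locallyIntegrable_of_Lp Φ _) hφ j).symm
  zero_mem' := by
    intro j φ hφ
    rw [Prod.fst_zero, Prod.snd_zero, pair_congr (coord_zero j),
      distD_congr (Lp.coeFn_zero ℂ 2 Φ.gibbs)]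
    simp [distD]
  smul_mem' := by
    intro c p hp j φ hφ
    have hp' := hp j φ hφ
    rw [Prod.smul_fst, Prod.smul_snd, pair_congr (coord_smul c p.2 j),
      distD_congr (Lp.coeFn_smul c p.1), pair_smul, hp']
    exact (distD_smul c _ j).symm

/-- Distributional derivatives are unique, so `graphD0` is the graph of an operator. -/
theorem graphD0_single_valued (Φ : Potential n) :
    ∀ p ∈ graphD0 Φ, p.1 = 0 → p.2 = 0 := by
  intro p hp h0
  refine eq_zero_of_pair_eq_zero _ fun j φ hφ => ?_
  rw [hp j φ hφ, h0, distD_congr (Lp.coeFn_zero ℂ 2 Φ.gibbs)]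
  simp [distD]

/-- The graph of `d₁`: pairs `(v, ω)` with `ω_{jk} = ∂ⱼ v_k - ∂_k vⱼ` (`j < k`) in the
distribution sense. -/
def graphD1 (Φ : Potential n) : Submodule ℂ (H1 Φ × H2 Φ) where
  carrier := {p | ∀ (jk : Pairs n) (φ : E n → ℂ), IsTest φ →
    ∫ x, p.2 x jk * φ x =
      distD (fun x => p.1 x jk.1.2) jk.1.1 φ - distD (fun x => p.1 x jk.1.1) jk.1.2 φ}
  add_mem' := by
    intro p q hp hq j φ hφ
    have hp' := hp j φ hφ
    have hq' := hq j φ hφ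
    rw [Prod.fst_add, Prod.snd_add, pair_congr (coord_add p.2 q.2 j),
      distD_congr (coord_add p.1 q.1 _), distD_congr (coord_add p.1 q.1 _),
      pair_add (locallyIntegrable_coord _ _) (locallyIntegrable_coord _ _) hφ, hp', hq',
      distD_add (locallyIntegrable_coord _ _) (locallyIntegrable_coord _ _) hφ,
      distD_add (locallyIntegrable_coord _ _) (locallyIntegrable_coord _ _) hφ]
    ring
  zero_mem' := by
    intro j φ hφ
    rw [Prod.fst_zero, Prod.snd_zero, pair_congr (coord_zero j), distD_congr (coord_zero _),
      distD_congr (coord_zero _)]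
    simp [distD]
  smul_mem' := by
    intro c p hp j φ hφ
    have hp' := hp j φ hφ
    rw [Prod.smul_fst, Prod.smul_snd, pair_congr (coord_smul c p.2 j),
      distD_congr (coord_smul c p.1 _), distD_congr (coord_smul c p.1 _), pair_smul, hp',
      distD_smul, distD_smul]
    ring

theorem graphD1_single_valued (Φ : Potential n) :
    ∀ p ∈ graphD1 Φ, p.1 = 0 → p.2 = 0 := by
  intro p hp h0
  refine eq_zero_of_pair_eq_zero _ fun j φ hφ => ?_
  rw [hp j φ hφ, h0, distD_congr (coord_zero _), distD_congr (coord_zero _)]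
  simp [distD]

/-- The differential `d₀` of functions, with its maximal domain `H¹(μ)` in `L²(μ)`. -/
def d0 (Φ : Potential n) : H0 Φ →ₗ.[ℂ] H1 Φ := (graphD0 Φ).toLinearPMap

/-- The differential `d₁` of 1-forms, with its maximal domain in `L²(μ, ⋀¹ ℂⁿ)`. -/
def d1 (Φ : Potential n) : H1 Φ →ₗ.[ℂ] H2 Φ := (graphD1 Φ).toLinearPMap

theorem d0_graph (Φ : Potential n) : (d0 Φ).graph = graphD0 Φ :=
  Submodule.toLinearPMap_graph_eq _ (graphD0_single_valued Φ)

theorem d1_graph (Φ : Potential n) : (d1 Φ).graph = graphD1 Φ :=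
  Submodule.toLinearPMap_graph_eq _ (graphD1_single_valued Φ)

/-! ### The Hodge Laplacians -/

/-- The product `g f` of unbounded operators, with domain `{x ∈ D(f) | f x ∈ D(g)}`. -/
def prodOp {A B C : Type*} [AddCommGroup A] [Module ℂ A] [AddCommGroup B] [Module ℂ B]
    [AddCommGroup C] [Module ℂ C] (g : B →ₗ.[ℂ] C) (f : A →ₗ.[ℂ] B) : A →ₗ.[ℂ] C where
  domain := (g.domain.comap f.toFun).map f.domain.subtype
  toFun := g.toFun ∘ₗ
    ((f.toFun ∘ₗ Submodule.inclusion (Submodule.map_subtype_le _ _)).codRestrict g.domain (by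
      rintro ⟨_, x, hx, rfl⟩
      exact hx))

/-- `A₀ = d₀* d₀`. -/
def A0 (Φ : Potential n) : H0 Φ →ₗ.[ℂ] H0 Φ := prodOp (d0 Φ)† (d0 Φ)

/-- `A₁ = d₁* d₁ + d₀ d₀*`, with `D(A₁) = D(d₁* d₁) ∩ D(d₀ d₀*)`. -/
def A1 (Φ : Potential n) : H1 Φ →ₗ.[ℂ] H1 Φ :=
  prodOp (d1 Φ)† (d1 Φ) + prodOp (d0 Φ) (d0 Φ)†

/-- `R(A₀)`. -/
def rangeA0 (Φ : Potential n) : Submodule ℂ (H0 Φ) := LinearMap.range (A0 Φ).toFun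

/-- `X`, the closure of `R(d₀)` in `L²(μ, ⋀¹ ℂⁿ)`. -/
def X1 (Φ : Potential n) : Submodule ℂ (H1 Φ) :=
  (LinearMap.range (d0 Φ).toFun).topologicalClosure

instance (Φ : Potential n) : CompleteSpace (X1 Φ) :=
  inferInstanceAs (CompleteSpace (LinearMap.range (d0 Φ).toFun).topologicalClosure)

/-! ### Constants and the mean -/

/-- The constant functions, as a subspace of `L²(μ)`. -/
def constants (Φ : Potential n) : Submodule ℂ (H0 Φ) :=
  Submodule.span ℂ {Lp.const 2 Φ.gibbs (1 : ℂ)}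

/-- `P u = u - ∫ u dμ`. -/
def P (Φ : Potential n) (u : H0 Φ) : H0 Φ :=
  u - Lp.const 2 Φ.gibbs (∫ x, u x ∂Φ.gibbs)

/-! ### The variational extension of `A₁` -/

/-- `V ∩ X`, where `V = D(d₁) ∩ D(d₀*)`. -/
def VXsub (Φ : Potential n) : Submodule ℂ (H1 Φ) :=
  ((d1 Φ).domain ⊓ (d0 Φ)†.domain) ⊓ X1 Φ

/-- The space `Ṽ = V ∩ X`. It is a type of its own, since it does not carry the norm of
`L²(μ, ⋀¹ ℂⁿ)` but the norm `‖d₀* v‖`. -/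
def VTilde (Φ : Potential n) : Type := VXsub Φ

namespace VTilde

variable (Φ : Potential n)

instance : AddCommGroup (VTilde Φ) := inferInstanceAs (AddCommGroup (VXsub Φ))

instance : Module ℂ (VTilde Φ) := inferInstanceAs (Module ℂ (VXsub Φ))

/-- The inclusion of `Ṽ` into `L²(μ, ⋀¹ ℂⁿ)`. -/
def toH1 : VTilde Φ →ₗ[ℂ] H1 Φ := (VXsub Φ).subtype

/-- `d₀*` on `Ṽ`. -/
def dstarₗ : VTilde Φ →ₗ[ℂ] H0 Φ :=
  (d0 Φ)†.toFun ∘ₗ Submodule.inclusion (inf_le_left.trans inf_le_right : VXsub Φ ≤ (d0 Φ)†.domain)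

/-- `Ṽ` is normed by `‖d₀* v‖`. -/
instance : SeminormedAddCommGroup (VTilde Φ) :=
  SeminormedAddCommGroup.induced (VTilde Φ) (H0 Φ) (dstarₗ Φ)

instance : NormedSpace ℂ (VTilde Φ) := NormedSpace.induced ℂ (VTilde Φ) (H0 Φ) (dstarₗ Φ)

theorem norm_eq (v : VTilde Φ) : ‖v‖ = ‖dstarₗ Φ v‖ := rfl

/-- `d₀* : Ṽ → L²(μ)` as a bounded operator. -/
def dstar : VTilde Φ →L[ℂ] H0 Φ :=
  (dstarₗ Φ).mkContinuous 1 fun v => by rw [one_mul, norm_eq]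

end VTilde

/-- The bilinear pairing `∫ f g dμ` on `L²(μ)`. -/
def pair0 (Φ : Potential n) : H0 Φ →L[ℂ] H0 Φ →L[ℂ] ℂ :=
  (ContinuousLinearMap.mul ℂ ℂ).lpPairing Φ.gibbs 2 2

theorem pair0_apply (Φ : Potential n) (f g : H0 Φ) :
    pair0 Φ f g = ∫ x, f x * g x ∂Φ.gibbs := by
  simp [pair0, ContinuousLinearMap.lpPairing_eq_integral]

/-- The bilinear pairing `∫ ∑ⱼ fⱼ wⱼ dμ` of 1-forms with coefficients in `L²(μ)`. -/
def pair1 (Φ : Potential n) (f w : H1 Φ) : ℂ := ∫ x, ∑ j, f x j * w x j ∂Φ.gibbs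

/-- The variational operator `Ã : Ṽ → Ṽ'` of the form `⟨d₀* ·, d₀* ·⟩`. Here `Ṽ'` is the linear
dual, so `(Ã v)(w) = ⟨d₀* w, d₀* v̄⟩ = ∫ (d₀* v)(d₀* w) dμ`. -/
def ATilde (Φ : Potential n) : VTilde Φ →L[ℂ] StrongDual ℂ (VTilde Φ) :=
  (pair0 Φ).bilinearComp (VTilde.dstar Φ) (VTilde.dstar Φ)

/-- The differential `d : L²(μ) → Ṽ'`, the transpose of `d₀* : Ṽ → L²(μ)`, that is,
`(d g)(w) = ∫ g (d₀* w) dμ`. -/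
def dDual (Φ : Potential n) : H0 Φ →L[ℂ] StrongDual ℂ (VTilde Φ) :=
  (pair0 Φ).bilinearComp (ContinuousLinearMap.id ℂ (H0 Φ)) (VTilde.dstar Φ)

theorem ATilde_apply (Φ : Potential n) (v w : VTilde Φ) :
    ATilde Φ v w = ∫ x, VTilde.dstar Φ v x * VTilde.dstar Φ w x ∂Φ.gibbs :=
  pair0_apply _ _ _

theorem dDual_apply (Φ : Potential n) (g : H0 Φ) (w : VTilde Φ) :
    dDual Φ g w = ∫ x, g x * VTilde.dstar Φ w x ∂Φ.gibbs :=
  pair0_apply _ _ _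

end WeightedComplex

end

open WeightedComplex

/-! ### Closed, densely defined operators between Hilbert spaces -/

/-! Everything rests on one fact: `d₀*` maps `Ṽ` isometrically onto the orthogonal complement `ℂ^⊥`
of the constants (`VTilde.dstarEquiv`). The isometry is the choice of norm. Injectivity holds
because a vector in the closure of `R(d₀)` killed by `d₀*` is orthogonal to itself. Surjectivity is
where closed range enters: `R(A₀)^⊥ = ker d₀ = ℂ`, so a closed `R(A₀)` is all of `ℂ^⊥`
(`rangeA0_eq`), and `d₀* d₀ w` is the image of `d₀ w ∈ X`.

Through this isometry `Ã` becomes the bilinear pairing on `ℂ^⊥`, an isomorphism onto the dual by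
Riesz, and `d g` becomes pairing with `P g`. Hence `Ã⁻¹ d g` is the `v` with `d₀* v = P g`
(`ATilde_eq_dDual_iff`); this is the projection formula, and pairing it with `g₂` is the covariance
identity.

On `X` the operator `d₁` vanishes, so `A₁` is `d₀ d₀*` there. A weak solution is a strong one
because the closed operator `d₀` contains its second adjoint (`mem_graph_of_adjoint_pairing`).

The analytic input is that `d₀` is closed and densely defined, that its kernel is the constants (by
mollification), and that `d₁ d₀ = 0`. Since `Ṽ'` is a linear dual while the Hilbert space arguments
are sesquilinear, conjugation, which commutes with `d₀`, mediates throughout. -/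

theorem eq_zero_of_inner_self_add_inner_self_eq_zero {H K : Type*} [NormedAddCommGroup H]
    [InnerProductSpace ℂ H] [NormedAddCommGroup K] [InnerProductSpace ℂ K] {a : H} {b : K}
    (h : (inner ℂ a a : ℂ) + inner ℂ b b = 0) : a = 0 ∧ b = 0 := by
  have h1 := congrArg Complex.re h
  have ha : (inner ℂ a a : ℂ).re = ‖a‖ ^ 2 := inner_self_eq_norm_sq (𝕜 := ℂ) a
  have hb : (inner ℂ b b : ℂ).re = ‖b‖ ^ 2 := inner_self_eq_norm_sq (𝕜 := ℂ) b
  rw [Complex.add_re, Complex.zero_re, ha, hb] at h1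
  exact ⟨norm_eq_zero.1 (by nlinarith [sq_nonneg ‖a‖, sq_nonneg ‖b‖]),
    norm_eq_zero.1 (by nlinarith [sq_nonneg ‖a‖, sq_nonneg ‖b‖])⟩

namespace LinearPMap

variable {H K : Type*} [NormedAddCommGroup H] [InnerProductSpace ℂ H] [CompleteSpace H]
  [NormedAddCommGroup K] [InnerProductSpace ℂ K] {T : H →ₗ.[ℂ] K}

/-- An element of the closure of the range of `T` that `T†` annihilates vanishes. -/
theorem eq_zero_of_adjoint_eq_zero (hd : Dense (T.domain : Set H)) {y : T†.domain}
    (hy : (y : K) ∈ (LinearMap.range T.toFun).topologicalClosure) (h : T† y = 0) :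
    (y : K) = 0 := by
  have h1 : (y : K) ∈ (LinearMap.range T.toFun)ᗮ := by
    rintro _ ⟨x, rfl⟩
    have := adjoint_isFormalAdjoint hd y x
    rw [h, inner_zero_left] at this
    rw [inner_eq_zero_symm]
    exact this.symm
  rw [← Submodule.orthogonal_closure] at h1
  exact inner_self_eq_zero.1 (h1 _ hy)

/-- Projecting onto the closure of the range of `T` does not change `T†`. -/
theorem exists_adjoint_starProjection (hd : Dense (T.domain : Set H)) (y : T†.domain)
    [((LinearMap.range T.toFun).topologicalClosure).HasOrthogonalProjection] :
    ∃ hv : (LinearMap.range T.toFun).topologicalClosure.starProjection (y : K) ∈ T†.domain,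
      T† ⟨_, hv⟩ = T† y := by
  set X := (LinearMap.range T.toFun).topologicalClosure
  have h' : ∀ x : T.domain, inner ℂ (T† y) (x : H) = inner ℂ (X.starProjection (y : K)) (T x) := by
    intro x
    rw [adjoint_isFormalAdjoint hd y x]
    have := X.starProjection_inner_eq_zero (y : K) (T x)
      (Submodule.le_topologicalClosure _ ⟨x, rfl⟩)
    rw [inner_sub_left] at this
    linear_combination this
  have hv := mem_adjoint_domain_of_exists _ ⟨_, h'⟩
  exact ⟨hv, adjoint_apply_eq hd ⟨_, hv⟩ h'⟩

variable [CompleteSpace K]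

/-- The orthogonal decomposition of `H × K` into the graph of a closed operator and the rotated
graph of its adjoint. -/
theorem exists_eq_graph_add_adjoint (hc : T.IsClosed) (hd : Dense (T.domain : Set H))
    (u : H) (f : K) :
    ∃ (w : T.domain) (b : T†.domain), u = w - T† b ∧ f = T w + b := by
  let G : Submodule ℂ (WithLp 2 (H × K)) :=
    T.graph.comap (WithLp.prodContinuousLinearEquiv 2 ℂ H K : _ →ₗ[ℂ] H × K)
  have hG : _root_.IsClosed (G : Set (WithLp 2 (H × K))) :=
    _root_.IsClosed.preimage (WithLp.prodContinuousLinearEquiv 2 ℂ H K).continuous hc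
  have : CompleteSpace G := hG.completeSpace_coe
  set z : WithLp 2 (H × K) := WithLp.toLp 2 (u, f) with hz
  set p : WithLp 2 (H × K) := G.starProjection z with hp
  have hpG : (p.fst, p.snd) ∈ T.graph := G.starProjection_apply_mem z
  obtain ⟨w, hw1, hw2⟩ := (LinearPMap.mem_graph_iff T).1 hpG
  -- The residual `(u - w, f - T w)` is orthogonal to the graph, which is exactly the adjoint
  -- relation `T†(f - T w) = -(u - w)`.
  have horth : ∀ x : T.domain, inner ℂ (-(u - w)) (x : H) = inner ℂ (f - T w) (T x) := by
    intro x
    have hx : (WithLp.toLp 2 ((x : H), T x) : WithLp 2 (H × K)) ∈ G := T.mem_graph x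
    have h := G.starProjection_inner_eq_zero z _ hx
    rw [← hp, WithLp.prod_inner_apply] at h
    simp only [WithLp.ofLp_sub, hz, Prod.fst_sub, Prod.snd_sub] at h
    change inner ℂ (u - p.fst) (x : H) + inner ℂ (f - p.snd) (T x) = 0 at h
    rw [← show (w : H) = p.fst from hw1, ← show T w = p.snd from hw2] at h
    rw [inner_neg_left]
    linear_combination -h
  have hb : f - T w ∈ T†.domain := mem_adjoint_domain_of_exists _ ⟨_, horth⟩
  refine ⟨w, ⟨f - T w, hb⟩, ?_, ?_⟩
  · rw [adjoint_apply_eq hd ⟨f - T w, hb⟩ (x₀ := -(u - w)) horth]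
    abel
  · simp

/-- A closed operator contains its second adjoint. -/
theorem mem_graph_of_adjoint_pairing (hc : T.IsClosed) (hd : Dense (T.domain : Set H))
    {u : H} {f : K} (h : ∀ y : T†.domain, inner ℂ (T† y) u = inner ℂ (y : K) f) :
    (u, f) ∈ T.graph := by
  obtain ⟨w, b, hu, hf⟩ := exists_eq_graph_add_adjoint hc hd u f
  -- Testing with `b` itself leaves `‖T† b‖² + ‖b‖² = 0`, so the component off the graph vanishes.
  have h1 := h b
  have h2 := adjoint_isFormalAdjoint hd b w
  rw [hu, hf, inner_sub_right, inner_add_right, h2] at h1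
  have h3 : (inner ℂ (T† b) (T† b) : ℂ) + inner ℂ (b : K) (b : K) = 0 := by
    linear_combination -h1
  obtain ⟨h5, h6⟩ := eq_zero_of_inner_self_add_inner_self_eq_zero h3
  rw [hu, hf, h5, h6, sub_zero, add_zero]
  exact T.mem_graph w

/-- `1 + T† T` is onto for a closed operator `T`. -/
theorem exists_eq_add_adjoint_apply (hc : T.IsClosed) (hd : Dense (T.domain : Set H)) (u : H) :
    ∃ (w : T.domain) (hw : T w ∈ T†.domain), u = w + T† ⟨T w, hw⟩ := by
  obtain ⟨w, b, hu, hf⟩ := exists_eq_graph_add_adjoint hc hd u 0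
  have hb : T w = ((-b : T†.domain) : K) := by
    rw [Submodule.coe_neg]
    exact eq_neg_of_add_eq_zero_left hf.symm
  refine ⟨w, hb ▸ (-b).2, ?_⟩
  have : (⟨T w, hb ▸ (-b).2⟩ : T†.domain) = -b := Subtype.ext hb
  rw [this, map_neg, hu, sub_eq_add_neg]

/-- A vector orthogonal to the range of `T† T` is in the kernel of `T`. -/
theorem mem_graph_zero_of_orthogonal (hc : T.IsClosed) (hd : Dense (T.domain : Set H)) {u : H}
    (h : ∀ (w : T.domain) (hw : T w ∈ T†.domain), inner ℂ (T† ⟨T w, hw⟩) u = 0) :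
    (u, 0) ∈ T.graph := by
  obtain ⟨w, hw, hu⟩ := exists_eq_add_adjoint_apply hc hd u
  -- With `u = w + T† T w`, orthogonality to `T† T w` reads `‖T w‖² + ‖T† T w‖² = 0`.
  have h1 := h w hw
  have h2 := adjoint_isFormalAdjoint hd ⟨T w, hw⟩ w
  rw [hu, inner_add_right, h2] at h1
  obtain ⟨h6, h5⟩ := eq_zero_of_inner_self_add_inner_self_eq_zero h1
  rw [hu, h5, add_zero, ← h6]
  exact T.mem_graph w

end LinearPMap

namespace WeightedComplex

variable {n : ℕ}

/-! ### Integration against the Gibbs measure -/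

section Weight

variable (Φ : Potential n) {F : Type*} [NormedAddCommGroup F] [InnerProductSpace ℂ F]

theorem integral_gibbs (f : E n → ℂ) :
    ∫ x, f x ∂Φ.gibbs = ∫ x, (Real.exp (-Φ.toFun x) : ℂ) * f x := by
  rw [Potential.gibbs, integral_withDensity_eq_integral_toReal_smul
    Φ.continuous_exp.measurable.ennreal_ofReal
    (Filter.Eventually.of_forall fun x => ENNReal.ofReal_lt_top)]
  refine integral_congr_ae (Filter.Eventually.of_forall fun x => ?_)
  dsimp only
  rw [ENNReal.toReal_ofReal (Real.exp_pos _).le, Complex.real_smul]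

/-- The factor `exp Φ` cancels the weight, so Lebesgue pairings with test functions become bounded
functionals on `L²(μ)`; compact support keeps the product square integrable. -/
theorem memLp_exp_smul {φ : E n → F} (hφ : Continuous φ) (hc : HasCompactSupport φ) :
    MemLp (fun x => (Real.exp (Φ.toFun x) : ℂ) • φ x) 2 Φ.gibbs := by
  have h : Continuous fun x => (Real.exp (Φ.toFun x) : ℂ) :=
    Complex.continuous_ofReal.comp (Real.continuous_exp.comp Φ.contDiff.continuous)
  exact (h.smul hφ).memLp_of_hasCompactSupport hc.smul_left

/-- The inner product with `exp Φ • φ` in `L²(μ)` is the Lebesgue pairing with `φ`. -/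
theorem inner_exp_smul {φ : E n → F} (hφ : Continuous φ) (hc : HasCompactSupport φ)
    (u : Lp F 2 Φ.gibbs) :
    inner ℂ ((memLp_exp_smul Φ hφ hc).toLp _) u = ∫ x, inner ℂ (φ x) (u x) := by
  rw [L2.inner_def]
  have h : ∫ x, inner ℂ ((memLp_exp_smul Φ hφ hc).toLp _ x) (u x) ∂Φ.gibbs =
      ∫ x, inner ℂ ((Real.exp (Φ.toFun x) : ℂ) • φ x) (u x) ∂Φ.gibbs :=
    integral_congr_ae ((memLp_exp_smul Φ hφ hc).coeFn_toLp.mono fun x hx => by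
      simp only [hx])
  rw [h, integral_gibbs]
  refine integral_congr_ae (Filter.Eventually.of_forall fun x => ?_)
  simp only [inner_smul_left, Complex.conj_ofReal]
  rw [← mul_assoc, ← Complex.ofReal_mul, ← Real.exp_add]
  simp

end Weight

/-! ### Test functions -/

section Test

variable {φ : E n → ℂ}

theorem IsTest.conj (hφ : IsTest φ) : IsTest fun x => star (φ x) :=
  ⟨Complex.conjCLE.contDiff.comp hφ.1, hφ.2.comp_left (g := fun z : ℂ => star z) (star_zero _)⟩

theorem partialD_star (hφ : IsTest φ) (j : Fin n) (x : E n) :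
    partialD j (fun x => star (φ x)) x = star (partialD j φ x) := by
  have h : HasFDerivAt (fun x => star (φ x))
      ((Complex.conjCLE : ℂ →L[ℝ] ℂ).comp (fderiv ℝ φ x)) x :=
    (Complex.conjCLE : ℂ →L[ℝ] ℂ).hasFDerivAt.comp x
      (hφ.1.differentiable (by simp) x).hasFDerivAt
  rw [partialD, h.fderiv]
  rfl

theorem partialD_comm (hφ : IsTest φ) (j k : Fin n) :
    partialD j (partialD k φ) = partialD k (partialD j φ) := by
  funext x
  have hd : DifferentiableAt ℝ (fderiv ℝ φ) x :=
    (hφ.1.fderiv_right (m := ∞) le_rfl).differentiable (by simp) x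
  have h : ∀ i l : Fin n, partialD i (partialD l φ) x =
      fderiv ℝ (fderiv ℝ φ) x (EuclideanSpace.single i 1) (EuclideanSpace.single l 1) := by
    intro i l
    unfold partialD
    rw [fderiv_clm_apply hd (differentiableAt_const _)]
    simp
  rw [h, h]
  have hs : IsSymmSndFDerivAt ℝ φ x := hφ.1.contDiffAt.isSymmSndFDerivAt (by
    simpa using (WithTop.coe_le_coe.2 le_top : ((2 : ℕ∞) : WithTop ℕ∞) ≤ ∞))
  exact hs _ _

theorem distD_partialD_comm (f : E n → ℂ) (hφ : IsTest φ) (j k : Fin n) :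
    distD f j (partialD k φ) = distD f k (partialD j φ) := by
  unfold distD
  rw [partialD_comm hφ]

theorem distD_star (f : E n → ℂ) (hφ : IsTest φ) (j : Fin n) :
    distD (fun x => star (f x)) j φ = star (distD f j fun x => star (φ x)) := by
  unfold distD
  rw [star_neg]
  congr 1
  refine Eq.trans ?_ integral_conj
  refine integral_congr_ae (Filter.Eventually.of_forall fun x => ?_)
  simp only [partialD_star hφ]
  simp

/-- Classical and distributional derivatives of a test function agree. -/
theorem integral_partialD_mul {f : E n → ℂ} (hf : IsTest f) (hφ : IsTest φ) (j : Fin n) :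
    ∫ x, partialD j f x * φ x = distD f j φ := by
  unfold distD partialD
  rw [integral_mul_fderiv_eq_neg_fderiv_mul_of_integrable, neg_neg]
  · exact integrable_mul_test (hf.partialD j).1.continuous.locallyIntegrable hφ
  · exact integrable_mul_test hf.1.continuous.locallyIntegrable (hφ.partialD j)
  · exact integrable_mul_test hf.1.continuous.locallyIntegrable hφ
  · exact fun x _ => hf.1.differentiable (by simp) x
  · exact fun x _ => hφ.1.differentiable (by simp) x

variable (Φ : Potential n)

theorem IsTest.inner_eq (hφ : IsTest φ) (u : H0 Φ) :
    inner ℂ ((memLp_exp_smul Φ hφ.conj.1.continuous hφ.conj.2).toLp _) u = ∫ x, u x * φ x := by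
  rw [inner_exp_smul Φ hφ.conj.1.continuous hφ.conj.2]
  refine integral_congr_ae (Filter.Eventually.of_forall fun x => ?_)
  simp

theorem IsTest.continuous_pair (hφ : IsTest φ) : Continuous fun u : H0 Φ => ∫ x, u x * φ x := by
  simp only [← hφ.inner_eq Φ]
  fun_prop

theorem IsTest.continuous_distD (hφ : IsTest φ) (j : Fin n) :
    Continuous fun u : H0 Φ => distD u j φ :=
  ((hφ.partialD j).continuous_pair Φ).neg

theorem IsTest.continuous_pair_coord {ι : Type*} [Fintype ι] (hφ : IsTest φ) (j : ι) :
    Continuous fun v : Lp (EuclideanSpace ℂ ι) 2 Φ.gibbs => ∫ x, v x j * φ x := by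
  classical
  let L : ℂ →L[ℝ] EuclideanSpace ℂ ι :=
    (ContinuousLinearMap.toSpanSingleton ℂ (EuclideanSpace.single j (1 : ℂ))).restrictScalars ℝ
  have h1 : Continuous fun x => L (star (φ x)) := L.continuous.comp hφ.conj.1.continuous
  have h2 : HasCompactSupport fun x => L (star (φ x)) := hφ.conj.2.comp_left (g := L) (map_zero L)
  have h : ∀ v : Lp (EuclideanSpace ℂ ι) 2 Φ.gibbs,
      ∫ x, v x j * φ x = inner ℂ ((memLp_exp_smul Φ h1 h2).toLp _) v := by
    intro v
    rw [inner_exp_smul Φ h1 h2]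
    refine integral_congr_ae (Filter.Eventually.of_forall fun x => ?_)
    simp [L, EuclideanSpace.inner_single_left, mul_comm]
  simp only [h]
  fun_prop

theorem IsTest.continuous_distD_coord {ι : Type*} [Fintype ι] (hφ : IsTest φ) (j : ι)
    (k : Fin n) :
    Continuous fun v : Lp (EuclideanSpace ℂ ι) 2 Φ.gibbs => distD (fun x => v x j) k φ :=
  ((hφ.partialD k).continuous_pair_coord Φ j).neg

end Test

/-! ### Functions with vanishing distributional gradient -/

theorem partialD_comp_sub {φ : E n → ℂ} (hφ : IsTest φ) (j : Fin n) (x t : E n) :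
    partialD j (fun t => φ (x - t)) t = -partialD j φ (x - t) := by
  have h : HasFDerivAt (fun t => φ (x - t))
      ((fderiv ℝ φ (x - t)).comp (-ContinuousLinearMap.id ℝ (E n))) t :=
    (hφ.1.differentiable (by simp) (x - t)).hasFDerivAt.comp t ((hasFDerivAt_id t).const_sub x)
  rw [partialD, h.fderiv]
  simp [partialD]

open scoped Convolution Topology in
/-- On `ℝⁿ`, a locally integrable function with zero distributional gradient is constant. -/
theorem exists_ae_eq_const_of_distD_eq_zero {f : E n → ℂ} (hf : LocallyIntegrable f volume)
    (h : ∀ (j : Fin n) (φ : E n → ℂ), IsTest φ → distD f j φ = 0) :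
    ∃ c : ℂ, f =ᵐ[volume] fun _ => c := by
  let B : ℂ →L[ℝ] ℂ →L[ℝ] ℂ := ContinuousLinearMap.mul ℝ ℂ
  have hconst : ∀ ρ : E n → ℂ, IsTest ρ → ∀ x, (f ⋆[B, volume] ρ) x = (f ⋆[B, volume] ρ) 0 := by
    intro ρ hρ x
    -- Each partial derivative of `f ⋆ ρ` at `y` is `distD f j` evaluated at the test function `t ↦
    -- ρ (y - t)`, the two signs cancelling. Hence every mollification of `f` is constant.
    have hder : ∀ y, HasFDerivAt (f ⋆[B, volume] ρ) (0 : E n →L[ℝ] ℂ) y := by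
      intro y
      have hy := hρ.2.hasFDerivAt_convolution_right B hf (hρ.1.of_le (by simp)) y
      set A := (f ⋆[B.precompR (E n), volume] fderiv ℝ ρ) y
      have hb : ∀ j : Fin n, A (EuclideanSpace.single j 1) = 0 := by
        intro j
        change (f ⋆[B.precompR (E n), volume] fderiv ℝ ρ) y (EuclideanSpace.single j 1) = 0
        rw [convolution_precompR_apply B hf (hρ.2.fderiv ℝ) (hρ.1.continuous_fderiv (by simp)),
          convolution_def]
        have ht : IsTest fun t => ρ (y - t) :=
          ⟨hρ.1.comp (contDiff_const.sub contDiff_id),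
            hρ.2.comp_homeomorph (Homeomorph.subLeft y)⟩
        have h0 := h j _ ht
        unfold distD at h0
        simp only [partialD_comp_sub hρ, mul_neg, integral_neg, neg_neg] at h0
        exact h0
      have hA : (A : E n →ₗ[ℝ] ℂ) = 0 :=
        (EuclideanSpace.basisFun (Fin n) ℝ).toBasis.ext fun j => by simpa using hb j
      rwa [show A = 0 from ContinuousLinearMap.coe_injective hA] at hy
    exact is_const_of_fderiv_eq_zero (𝕜 := ℝ) (fun y => (hder y).differentiableAt)
      (fun y => (hder y).fderiv) x 0
  -- The radii shrink to zero with fixed ratio 2; the bounded ratio is what gives almost everywhere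
  -- convergence for a merely locally integrable `f`.
  let ψ : ℕ → ContDiffBump (0 : E n) := fun i =>
    ⟨((i : ℝ) + 1)⁻¹, 2 * ((i : ℝ) + 1)⁻¹, by positivity, by
      have : (0 : ℝ) < ((i : ℝ) + 1)⁻¹ := by positivity
      linarith⟩
  have hlim := ContDiffBump.ae_convolution_tendsto_right_of_locallyIntegrable
    (μ := (volume : Measure (E n))) (φ := ψ) (l := Filter.atTop) (K := 2) (by
      have := (tendsto_one_div_add_atTop_nhds_zero_nat (𝕜 := ℝ)).const_mul 2
      simpa [ψ] using this) (Filter.Eventually.of_forall fun i => le_rfl) hf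
  have hswap : ∀ i x, ((ψ i).normed volume ⋆[ContinuousLinearMap.lsmul ℝ ℝ, volume] f) x =
      ((ψ i).normed volume ⋆[ContinuousLinearMap.lsmul ℝ ℝ, volume] f) 0 := by
    intro i x
    have ht : IsTest fun x => (((ψ i).normed volume x : ℝ) : ℂ) :=
      ⟨Complex.ofRealCLM.contDiff.comp (ψ i).contDiff_normed,
        (ψ i).hasCompactSupport_normed.comp_left (g := fun r : ℝ => (r : ℂ)) (by simp)⟩
    have he : ∀ x, ((ψ i).normed volume ⋆[ContinuousLinearMap.lsmul ℝ ℝ, volume] f) x =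
        (f ⋆[B, volume] fun x => (((ψ i).normed volume x : ℝ) : ℂ)) x := by
      intro x
      rw [convolution_eq_swap, convolution_def]
      refine integral_congr_ae (Filter.Eventually.of_forall fun t => ?_)
      simp [B, mul_comm]
    rw [he, he, hconst _ ht]
  obtain ⟨x₀, hx₀⟩ := hlim.exists
  refine ⟨f x₀, hlim.mono fun x hx => ?_⟩
  -- The mollifications take the same value at `x` and at `x₀`, so their limits `f x` and `f x₀`
  -- agree.
  refine tendsto_nhds_unique hx ?_
  simp only [hswap _ x]
  simpa only [hswap _ x₀] using hx₀

end WeightedComplex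

namespace WeightedComplex

variable {n : ℕ} (Φ : Potential n)

/-! ### The operators `d₀` and `d₁` -/

/-- For a fixed test function, both sides of the defining identity are continuous in the `L²(μ)`
norms, so the graph is an intersection of closed sets. -/
theorem isClosed_d0 : (d0 Φ).IsClosed := by
  rw [LinearPMap.IsClosed, d0_graph]
  have h : (graphD0 Φ : Set (H0 Φ × H1 Φ)) = ⋂ (j : Fin n) (φ : E n → ℂ) (_ : IsTest φ),
      {p | ∫ x, p.2 x j * φ x = distD p.1 j φ} := by
    ext p
    simp only [Set.mem_iInter]
    rfl
  rw [h]
  exact isClosed_iInter fun j => isClosed_iInter fun φ => isClosed_iInter fun hφ =>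
    isClosed_eq ((hφ.continuous_pair_coord Φ j).comp continuous_snd)
      ((hφ.continuous_distD Φ j).comp continuous_fst)

/-- `d₁ d₀ = 0`, up to closures. -/
theorem mem_graphD1_of_mem_X1 {v : H1 Φ} (hv : v ∈ X1 Φ) : (v, 0) ∈ graphD1 Φ := by
  have hcl : _root_.IsClosed {v : H1 Φ | (v, 0) ∈ graphD1 Φ} := by
    have h : {v : H1 Φ | (v, 0) ∈ graphD1 Φ} =
        ⋂ (jk : Pairs n) (φ : E n → ℂ) (_ : IsTest φ),
          {v | ∫ x, (0 : H2 Φ) x jk * φ x =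
            distD (fun x => v x jk.1.2) jk.1.1 φ - distD (fun x => v x jk.1.1) jk.1.2 φ} := by
      ext p
      simp only [Set.mem_iInter]
      rfl
    rw [h]
    exact isClosed_iInter fun j => isClosed_iInter fun φ => isClosed_iInter fun hφ =>
      isClosed_eq continuous_const
        ((hφ.continuous_distD_coord Φ _ _).sub (hφ.continuous_distD_coord Φ _ _))
  refine closure_minimal ?_ hcl hv
  rintro _ ⟨u, rfl⟩ jk φ hφ
  have hu : ((u : H0 Φ), d0 Φ u) ∈ graphD0 Φ := d0_graph Φ ▸ (d0 Φ).mem_graph u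
  have h : ∀ j k, distD (fun x => (d0 Φ u) x j) k φ = -distD u j (partialD k φ) := fun j k => by
    rw [← hu j _ (hφ.partialD k)]
    rfl
  change ∫ x, (0 : H2 Φ) x jk * φ x = distD (fun x => (d0 Φ u) x jk.1.2) jk.1.1 φ -
    distD (fun x => (d0 Φ u) x jk.1.1) jk.1.2 φ
  rw [h, h, distD_partialD_comm _ hφ, sub_self, pair_congr (coord_zero jk)]
  simp

theorem mem_domain_d1_of_mem_X1 {v : H1 Φ} (hv : v ∈ X1 Φ) : v ∈ (d1 Φ).domain :=
  LinearPMap.mem_domain_of_mem_graph (d1_graph Φ ▸ mem_graphD1_of_mem_X1 Φ hv)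

/-- A test function, as an element of `L²(μ)`, is in the domain of `d₀`. -/
theorem toLp_mem_domain_d0 {φ : E n → ℂ} (hφ : IsTest φ) :
    (hφ.1.continuous.memLp_of_hasCompactSupport hφ.2).toLp φ ∈ (d0 Φ).domain := by
  have hg : ContDiff ℝ ∞ fun x => (WithLp.toLp 2 fun j => partialD j φ x : EuclideanSpace ℂ (Fin n)) :=
    (contDiff_piLp 2).2 fun j => (hφ.partialD j).1
  have hgc : HasCompactSupport fun x => (WithLp.toLp 2 fun j => partialD j φ x : EuclideanSpace ℂ (Fin n)) :=
    (hφ.2.fderiv ℝ).comp_left (g := fun L : E n →L[ℝ] ℂ =>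
      (WithLp.toLp 2 fun j => L (EuclideanSpace.single j 1) : EuclideanSpace ℂ (Fin n))) (by
        ext j
        simp)
  have hm : MemLp _ 2 Φ.gibbs := hg.continuous.memLp_of_hasCompactSupport hgc
  refine LinearPMap.mem_domain_of_mem_graph (y := hm.toLp _) ?_
  rw [d0_graph]
  intro j ψ hψ
  have h1 := (hφ.1.continuous.memLp_of_hasCompactSupport (μ := Φ.gibbs) (p := 2) hφ.2).coeFn_toLp
  have h2 : (fun x => hm.toLp _ x j) =ᵐ[Φ.gibbs] partialD j φ :=
    hm.coeFn_toLp.mono fun x hx => congrArg (fun z : EuclideanSpace ℂ (Fin n) => z j) hx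
  rw [pair_congr h2, distD_congr h1]
  exact integral_partialD_mul hφ hψ j

theorem dense_domain_d0 : Dense ((d0 Φ).domain : Set (H0 Φ)) := by
  rw [Submodule.dense_iff_topologicalClosure_eq_top, Submodule.topologicalClosure_eq_top_iff,
    Submodule.eq_bot_iff]
  intro u hu
  -- A vector `u` orthogonal to all test functions in `L²(μ)` makes `exp (-Φ) u` vanish as a
  -- distribution; the weight is positive, so `u` vanishes too.
  have hloc : LocallyIntegrable (fun x => (Real.exp (-Φ.toFun x) : ℂ) * u x) volume := by
    rw [locallyIntegrable_iff]
    intro K hK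
    exact ((locallyIntegrable_of_Lp Φ u).integrableOn_isCompact hK).continuousOn_mul
      (Complex.continuous_ofReal.comp Φ.continuous_exp).continuousOn hK
  have h : ∀ᵐ x ∂(volume : Measure (E n)), (Real.exp (-Φ.toFun x) : ℂ) * u x = 0 := by
    refine ae_eq_zero_of_integral_contDiff_smul_eq_zero hloc fun g hg hgs => ?_
    have ht : IsTest fun x => (g x : ℂ) := ⟨Complex.ofRealCLM.contDiff.comp hg,
      hgs.comp_left (g := fun r : ℝ => (r : ℂ)) (by simp)⟩
    have h0 := hu _ (toLp_mem_domain_d0 Φ ht)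
    rw [L2.inner_def] at h0
    have h1 : ∫ x, inner ℂ ((ht.1.continuous.memLp_of_hasCompactSupport ht.2).toLp _ x) (u x)
        ∂Φ.gibbs = ∫ x, u x * g x ∂Φ.gibbs :=
      integral_congr_ae ((ht.1.continuous.memLp_of_hasCompactSupport (μ := Φ.gibbs) (p := 2)
        ht.2).coeFn_toLp.mono fun x hx => by
          dsimp only
          rw [hx]
          simp)
    rw [h1, integral_gibbs] at h0
    rw [← h0]
    refine integral_congr_ae (Filter.Eventually.of_forall fun x => ?_)
    simp only [Complex.real_smul]
    ring
  rw [Lp.eq_zero_iff_ae_eq_zero]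
  refine Φ.absolutelyContinuous_volume.ae_le (h.mono fun x hx => ?_)
  simpa [Real.exp_ne_zero] using hx

/-! ### The kernel of `d₀` -/

theorem mem_constants_iff {u : H0 Φ} : u ∈ constants Φ ↔ ∃ c : ℂ, u =ᵐ[Φ.gibbs] fun _ => c := by
  rw [constants, Submodule.mem_span_singleton]
  refine exists_congr fun c => ?_
  have h : (c • Lp.const 2 Φ.gibbs (1 : ℂ) : H0 Φ) =ᵐ[Φ.gibbs] fun _ => c := by
    filter_upwards [Lp.coeFn_smul c (Lp.const 2 Φ.gibbs (1 : ℂ)),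
      Lp.coeFn_const (μ := Φ.gibbs) (p := 2) (c := (1 : ℂ))] with x h1 h2
    rw [h1, Pi.smul_apply, h2]
    simp
  constructor
  · rintro rfl
    exact h
  · intro hu
    exact Lp.ext (h.trans hu.symm)

theorem distD_const (c : ℂ) (j : Fin n) {φ : E n → ℂ} (hφ : IsTest φ) :
    distD (fun _ => c) j φ = 0 := by
  unfold distD partialD
  rw [integral_mul_fderiv_eq_neg_fderiv_mul_of_integrable (f := fun _ => c) (by simp)
    (integrable_mul_test (continuous_const (y := c)).locallyIntegrable (hφ.partialD j))
    (integrable_mul_test (continuous_const (y := c)).locallyIntegrable hφ)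
    (fun x _ => differentiableAt_const c) (fun x _ => hφ.1.differentiable (by simp) x)]
  simp

/-- The kernel of `d₀` consists of the constants. -/
theorem mem_graphD0_zero_iff {u : H0 Φ} : (u, 0) ∈ graphD0 Φ ↔ u ∈ constants Φ := by
  have h0 : ∀ (j : Fin n) (φ : E n → ℂ), ∫ x, (0 : H1 Φ) x j * φ x = 0 := fun j φ => by
    rw [pair_congr (coord_zero j)]
    simp
  rw [mem_constants_iff]
  constructor
  · intro h
    obtain ⟨c, hc⟩ := exists_ae_eq_const_of_distD_eq_zero (locallyIntegrable_of_Lp Φ u)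
      fun j φ hφ => (h j φ hφ).symm.trans (h0 j φ)
    exact ⟨c, Φ.absolutelyContinuous_volume.ae_le hc⟩
  · rintro ⟨c, hc⟩ j φ hφ
    change ∫ x, (0 : H1 Φ) x j * φ x = distD u j φ
    rw [h0, distD_congr hc, distD_const c j hφ]

/-! ### Complex conjugation -/

/-- Passes from the bilinear pairings of the linear dual `Ṽ'` to the Hilbert scalar product. -/
theorem pair0_eq_inner (f g : H0 Φ) : pair0 Φ f g = inner ℂ (star f) g := by
  rw [pair0_apply, L2.inner_def]
  refine integral_congr_ae ((Lp.coeFn_star f).mono fun x hx => ?_)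
  dsimp only
  rw [hx]
  simp [mul_comm]

theorem norm_star_H0 (f : H0 Φ) : ‖star f‖ = ‖f‖ := by
  rw [Lp.norm_def, Lp.norm_def]
  congr 1
  refine eLpNorm_congr_norm_ae ((Lp.coeFn_star f).mono fun x hx => ?_)
  rw [hx]
  simp

/-- Coefficientwise complex conjugation on `ℂ^ι`. -/
noncomputable def conjCoord (ι : Type*) [Fintype ι] :
    EuclideanSpace ℂ ι →L[ℝ] EuclideanSpace ℂ ι :=
  ((PiLp.continuousLinearEquiv 2 ℝ fun _ : ι => ℂ).symm : (ι → ℂ) →L[ℝ] EuclideanSpace ℂ ι).comp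
    (ContinuousLinearMap.pi fun j => (Complex.conjCLE : ℂ →L[ℝ] ℂ).comp
      ((EuclideanSpace.proj j : EuclideanSpace ℂ ι →L[ℂ] ℂ).restrictScalars ℝ))

theorem conjCoord_apply {ι : Type*} [Fintype ι] (z : EuclideanSpace ℂ ι) (j : ι) :
    conjCoord ι z j = star (z j) := rfl

/-- Complex conjugation of 1-forms. -/
noncomputable def conjForm : H1 Φ →L[ℝ] H1 Φ := (conjCoord (Fin n)).compLpL 2 Φ.gibbs

theorem conjForm_coord (v : H1 Φ) (j : Fin n) :
    (fun x => conjForm Φ v x j) =ᵐ[Φ.gibbs] fun x => star (v x j) :=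
  ((conjCoord (Fin n)).coeFn_compLpL v).mono fun x hx => by
    change (conjCoord (Fin n)).compLpL 2 Φ.gibbs v x j = _
    rw [hx, conjCoord_apply]

theorem conjForm_conjForm (v : H1 Φ) : conjForm Φ (conjForm Φ v) = v := by
  refine Lp.ext ?_
  filter_upwards [ae_all_iff.2 (conjForm_coord Φ (conjForm Φ v)),
    ae_all_iff.2 (conjForm_coord Φ v)] with x h1 h2
  ext j
  rw [h1, h2, star_star]

theorem pair1_eq_inner (f w : H1 Φ) : pair1 Φ f w = inner ℂ (conjForm Φ f) w := by
  rw [pair1, L2.inner_def]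
  refine integral_congr_ae ?_
  filter_upwards [ae_all_iff.2 (conjForm_coord Φ f)] with x hx
  rw [PiLp.inner_apply]
  exact Finset.sum_congr rfl fun j _ => by
    rw [hx j]
    simp [mul_comm]

/-- The operator `d₀` has real coefficients, and conjugation preserves the class of test functions.
-/
theorem star_mem_graphD0 {u : H0 Φ} {v : H1 Φ} (h : (u, v) ∈ graphD0 Φ) :
    (star u, conjForm Φ v) ∈ graphD0 Φ := by
  intro j φ hφ
  change ∫ x, conjForm Φ v x j * φ x = distD (star u : H0 Φ) j φ
  have h1 : (star u : H0 Φ) =ᵐ[Φ.gibbs] fun x => star (u x) := Lp.coeFn_star u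
  rw [pair_congr (conjForm_coord Φ v j), distD_congr h1, distD_star _ hφ,
    ← h j _ hφ.conj]
  refine Eq.trans ?_ integral_conj
  refine integral_congr_ae (Filter.Eventually.of_forall fun x => ?_)
  simp

theorem conjForm_mem_X1 {v : H1 Φ} (hv : v ∈ X1 Φ) : conjForm Φ v ∈ X1 Φ := by
  refine map_mem_closure (conjForm Φ).continuous hv ?_
  rintro _ ⟨u, rfl⟩
  have hu : ((u : H0 Φ), d0 Φ u) ∈ graphD0 Φ := d0_graph Φ ▸ (d0 Φ).mem_graph u
  have h := star_mem_graphD0 Φ hu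
  rw [← d0_graph] at h
  obtain ⟨y, -, hy⟩ := (LinearPMap.mem_graph_iff _).1 h
  exact ⟨y, hy⟩

/-- The bilinear form of the adjoint relation between `d₀` and `d₀*`. -/
theorem pair0_adjoint (u : (d0 Φ).domain) (w : (d0 Φ)†.domain) :
    pair0 Φ u ((d0 Φ)† w) = pair1 Φ (d0 Φ u) w := by
  have hu : ((u : H0 Φ), d0 Φ u) ∈ graphD0 Φ := d0_graph Φ ▸ (d0 Φ).mem_graph u
  have h := star_mem_graphD0 Φ hu
  rw [← d0_graph] at h
  obtain ⟨y, hy1, hy2⟩ := (LinearPMap.mem_graph_iff _).1 h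
  rw [pair0_eq_inner, pair1_eq_inner, ← show (y : H0 Φ) = star (u : H0 Φ) from hy1,
    ← show d0 Φ y = conjForm Φ (d0 Φ u) from hy2]
  exact ((LinearPMap.adjoint_isFormalAdjoint (dense_domain_d0 Φ)).symm y w).symm

end WeightedComplex

namespace WeightedComplex

variable {n : ℕ}

/-! ### Graphs of products and sums -/

theorem mem_graph_prodOp {A B C : Type*} [AddCommGroup A] [Module ℂ A] [AddCommGroup B]
    [Module ℂ B] [AddCommGroup C] [Module ℂ C] (g : B →ₗ.[ℂ] C) (f : A →ₗ.[ℂ] B) {x : A} {z : C} :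
    (x, z) ∈ (prodOp g f).graph ↔ ∃ y, (x, y) ∈ f.graph ∧ (y, z) ∈ g.graph := by
  constructor
  · intro h
    obtain ⟨⟨_, x', hx', rfl⟩, rfl, rfl⟩ := (LinearPMap.mem_graph_iff _).1 h
    exact ⟨f x', f.mem_graph x', g.mem_graph ⟨f x', hx'⟩⟩
  · rintro ⟨y, hxy, hyz⟩
    obtain ⟨x', rfl, rfl⟩ := (LinearPMap.mem_graph_iff _).1 hxy
    obtain ⟨y', hy', rfl⟩ := (LinearPMap.mem_graph_iff _).1 hyz
    have hx' : f x' ∈ g.domain := by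
      rw [← show (y' : B) = f x' from hy']
      exact y'.2
    obtain rfl : y' = ⟨f x', hx'⟩ := Subtype.ext hy'
    exact (prodOp g f).mem_graph ⟨x', x', hx', rfl⟩

theorem mem_graph_add {A B : Type*} [AddCommGroup A] [Module ℂ A] [AddCommGroup B] [Module ℂ B]
    (f g : A →ₗ.[ℂ] B) {x : A} {z : B} :
    (x, z) ∈ (f + g).graph ↔ ∃ a b, (x, a) ∈ f.graph ∧ (x, b) ∈ g.graph ∧ a + b = z := by
  constructor
  · intro h
    obtain ⟨⟨x', hx'⟩, rfl, rfl⟩ := (LinearPMap.mem_graph_iff _).1 h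
    exact ⟨_, _, f.mem_graph ⟨x', hx'.1⟩, g.mem_graph ⟨x', hx'.2⟩, rfl⟩
  · rintro ⟨a, b, hf, hg, rfl⟩
    obtain ⟨x', rfl, rfl⟩ := (LinearPMap.mem_graph_iff _).1 hf
    obtain ⟨x'', hx, rfl⟩ := (LinearPMap.mem_graph_iff _).1 hg
    have hx' : (x' : A) ∈ g.domain := by
      rw [← show (x'' : A) = x' from hx]
      exact x''.2
    obtain rfl : x'' = ⟨x', hx'⟩ := Subtype.ext hx
    exact (f + g).mem_graph ⟨x', x'.2, hx'⟩

variable (Φ : Potential n)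

/-- On `X` the form `d₁ v` is zero, so the summand `d₁* d₁` contributes neither a value nor a domain
condition. -/
theorem mem_graph_A1_of_mem_X1 {v f : H1 Φ} (hv : v ∈ X1 Φ) :
    (v, f) ∈ (A1 Φ).graph ↔ ∃ u, (v, u) ∈ (d0 Φ)†.graph ∧ (u, f) ∈ (d0 Φ).graph := by
  have hd1 : (v, 0) ∈ (d1 Φ).graph := d1_graph Φ ▸ mem_graphD1_of_mem_X1 Φ hv
  rw [A1, mem_graph_add]
  constructor
  · rintro ⟨a, b, ha, hb, rfl⟩
    obtain ⟨y, hy, hya⟩ := (mem_graph_prodOp _ _).1 ha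
    obtain rfl : y = 0 := (d1 Φ).mem_graph_snd_inj hy hd1 rfl
    obtain rfl : a = 0 := LinearPMap.graph_fst_eq_zero_snd _ hya rfl
    rw [zero_add]
    exact (mem_graph_prodOp _ _).1 hb
  · intro h
    exact ⟨0, f, (mem_graph_prodOp _ _).2 ⟨0, hd1, Submodule.zero_mem _⟩,
      (mem_graph_prodOp _ _).2 h, zero_add f⟩

/-! ### The mean -/

theorem finiteDimensional_constants : FiniteDimensional ℂ (constants Φ) :=
  inferInstanceAs (FiniteDimensional ℂ (Submodule.span ℂ {Lp.const 2 Φ.gibbs (1 : ℂ)}))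

theorem const_mem_constants (c : ℂ) : Lp.const 2 Φ.gibbs c ∈ constants Φ :=
  (mem_constants_iff Φ).2 ⟨c, Lp.coeFn_const _ _ c⟩

theorem star_mem_constants {u : H0 Φ} (hu : u ∈ constants Φ) : star u ∈ constants Φ := by
  obtain ⟨c, hc⟩ := (mem_constants_iff Φ).1 hu
  refine (mem_constants_iff Φ).2 ⟨star c, ?_⟩
  filter_upwards [Lp.coeFn_star u, hc] with x h1 h2
  rw [h1, Pi.star_apply, h2]

theorem mem_constants_orthogonal_iff {u : H0 Φ} :
    u ∈ (constants Φ)ᗮ ↔ ∫ x, u x ∂Φ.gibbs = 0 := by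
  rw [constants, Submodule.mem_orthogonal_singleton_iff_inner_right, L2.inner_def]
  have h : ∫ x, inner ℂ (Lp.const 2 Φ.gibbs (1 : ℂ) x) (u x) ∂Φ.gibbs = ∫ x, u x ∂Φ.gibbs :=
    integral_congr_ae ((Lp.coeFn_const 2 Φ.gibbs (1 : ℂ)).mono fun x hx => by
      dsimp only
      rw [hx]
      simp)
  rw [h]

theorem star_mem_constants_orthogonal {u : H0 Φ} (hu : u ∈ (constants Φ)ᗮ) :
    star u ∈ (constants Φ)ᗮ := by
  rw [mem_constants_orthogonal_iff] at hu ⊢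
  rw [integral_congr_ae (Lp.coeFn_star u)]
  refine (integral_conj (f := fun x => u x)).trans ?_
  rw [hu, map_zero]

theorem P_mem_constants_orthogonal (u : H0 Φ) : P Φ u ∈ (constants Φ)ᗮ := by
  rw [mem_constants_orthogonal_iff, P]
  have h : (u - Lp.const 2 Φ.gibbs (∫ x, u x ∂Φ.gibbs) : H0 Φ) =ᵐ[Φ.gibbs]
      fun x => u x - ∫ x, u x ∂Φ.gibbs := by
    filter_upwards [Lp.coeFn_sub u (Lp.const 2 Φ.gibbs (∫ x, u x ∂Φ.gibbs)),
      Lp.coeFn_const 2 Φ.gibbs (∫ x, u x ∂Φ.gibbs)] with x h1 h2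
    rw [h1, Pi.sub_apply, h2]
    rfl
  rw [integral_congr_ae h, integral_sub ((Lp.memLp u).integrable (by norm_num))
    (integrable_const _)]
  simp

theorem sub_P_mem_constants (u : H0 Φ) : u - P Φ u ∈ constants Φ := by
  rw [P, sub_sub_cancel]
  exact const_mem_constants Φ _

theorem P_eq_starProjection (u : H0 Φ) : P Φ u = (constants Φ)ᗮ.starProjection u :=
  (Submodule.eq_starProjection_of_mem_orthogonal (P_mem_constants_orthogonal Φ u)
    ((constants Φ).le_orthogonal_orthogonal (sub_P_mem_constants Φ u))).symm

theorem inner_P_P (f g : H0 Φ) : inner ℂ (P Φ f) (P Φ g) = inner ℂ f (P Φ g) := by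
  have h := P_mem_constants_orthogonal Φ g _ (sub_P_mem_constants Φ f)
  rw [inner_sub_left] at h
  exact (sub_eq_zero.1 h).symm

/-- Used with `g` in the range of `d₀*`: the functional `d f` sees only `P f`. -/
theorem pair0_P {f g : H0 Φ} (hg : g ∈ (constants Φ)ᗮ) : pair0 Φ (P Φ f) g = pair0 Φ f g := by
  have h := hg _ (star_mem_constants Φ (sub_P_mem_constants Φ f))
  rw [← pair0_eq_inner, map_sub] at h
  exact (sub_eq_zero.1 h).symm

/-! ### The range of `A₀` -/

theorem mem_rangeA0_iff {z : H0 Φ} :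
    z ∈ rangeA0 Φ ↔ ∃ (w : (d0 Φ).domain) (hw : d0 Φ w ∈ (d0 Φ)†.domain),
      (d0 Φ)† ⟨d0 Φ w, hw⟩ = z := by
  constructor
  · rintro ⟨⟨_, w, hw, rfl⟩, rfl⟩
    exact ⟨w, hw, rfl⟩
  · rintro ⟨w, hw, rfl⟩
    exact ⟨⟨w, w, hw, rfl⟩, rfl⟩

theorem adjoint_mem_constants_orthogonal (y : (d0 Φ)†.domain) :
    (d0 Φ)† y ∈ (constants Φ)ᗮ := by
  intro c hc
  have h := (mem_graphD0_zero_iff Φ).2 hc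
  rw [← d0_graph] at h
  obtain ⟨x, rfl, hx⟩ := (LinearPMap.mem_graph_iff _).1 h
  rw [inner_eq_zero_symm, LinearPMap.adjoint_isFormalAdjoint (dense_domain_d0 Φ) y x,
    show d0 Φ x = 0 from hx, inner_zero_right]

variable {Φ}

/-- The orthogonal complement of `R(d₀* d₀)` is `ker d₀`, the constants; closedness turns density in
`ℂ^⊥` into equality. -/
theorem rangeA0_eq (hcl : IsClosed (rangeA0 Φ : Set (H0 Φ))) : rangeA0 Φ = (constants Φ)ᗮ := by
  have : CompleteSpace (rangeA0 Φ) := hcl.completeSpace_coe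
  refine le_antisymm ?_ ?_
  · intro z hz
    obtain ⟨w, hw, rfl⟩ := (mem_rangeA0_iff Φ).1 hz
    exact adjoint_mem_constants_orthogonal Φ _
  · rw [← (rangeA0 Φ).orthogonal_orthogonal]
    refine Submodule.orthogonal_le fun u hu => ?_
    rw [← mem_graphD0_zero_iff, ← d0_graph]
    exact LinearPMap.mem_graph_zero_of_orthogonal (isClosed_d0 Φ) (dense_domain_d0 Φ)
      fun w hw => hu _ ((mem_rangeA0_iff Φ).2 ⟨w, hw, rfl⟩)

/-! ### The variational space -/

namespace VTilde

theorem exists_of_mem {y : (d0 Φ)†.domain} (hy : (y : H1 Φ) ∈ X1 Φ) :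
    ∃ v : VTilde Φ, toH1 Φ v = y ∧ dstar Φ v = (d0 Φ)† y :=
  ⟨⟨y, ⟨mem_domain_d1_of_mem_X1 Φ hy, y.2⟩, hy⟩, rfl, rfl⟩

theorem toH1_injective : Function.Injective (toH1 Φ) := Subtype.val_injective

theorem toH1_mem_X1 (v : VTilde Φ) : toH1 Φ v ∈ X1 Φ := v.2.2

theorem toH1_mem_domain (v : VTilde Φ) : toH1 Φ v ∈ (d0 Φ)†.domain := v.2.1.2

theorem dstar_eq (v : VTilde Φ) : dstar Φ v = (d0 Φ)† ⟨toH1 Φ v, toH1_mem_domain v⟩ := rfl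

theorem mem_graph_adjoint_iff (v : VTilde Φ) {u : H0 Φ} :
    (toH1 Φ v, u) ∈ (d0 Φ)†.graph ↔ u = dstar Φ v := by
  have h := (d0 Φ)†.mem_graph ⟨toH1 Φ v, toH1_mem_domain v⟩
  constructor
  · intro hu
    exact (d0 Φ)†.mem_graph_snd_inj hu h rfl
  · rintro rfl
    exact h

theorem dstar_mem (v : VTilde Φ) : dstar Φ v ∈ (constants Φ)ᗮ :=
  adjoint_mem_constants_orthogonal Φ _

/-- This makes the seminorm `‖d₀* v‖` a norm. -/
theorem dstar_injective : Function.Injective (dstar Φ) := by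
  rw [injective_iff_map_eq_zero]
  intro v hv
  apply toH1_injective
  rw [map_zero]
  exact LinearPMap.eq_zero_of_adjoint_eq_zero (dense_domain_d0 Φ)
    (y := ⟨toH1 Φ v, toH1_mem_domain v⟩) (toH1_mem_X1 v) hv

theorem exists_dstar_eq (hcl : IsClosed (rangeA0 Φ : Set (H0 Φ))) {f : H0 Φ}
    (hf : f ∈ (constants Φ)ᗮ) : ∃ v : VTilde Φ, dstar Φ v = f := by
  rw [← rangeA0_eq hcl, mem_rangeA0_iff] at hf
  obtain ⟨w, hw, rfl⟩ := hf
  obtain ⟨v, -, hv⟩ := exists_of_mem (y := ⟨d0 Φ w, hw⟩)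
    (Submodule.le_topologicalClosure _ ⟨w, rfl⟩)
  exact ⟨v, hv⟩

/-- `d₀*` is an isometry of `Ṽ` onto the orthogonal complement of the constants. -/
noncomputable def dstarEquiv (hcl : IsClosed (rangeA0 Φ : Set (H0 Φ))) :
    VTilde Φ ≃ₗᵢ[ℂ] (constants Φ)ᗮ where
  toLinearEquiv := LinearEquiv.ofBijective
    ((dstar Φ : VTilde Φ →ₗ[ℂ] H0 Φ).codRestrict (constants Φ)ᗮ dstar_mem)
    ⟨fun _ _ h => dstar_injective (congrArg Subtype.val h), fun f => by
      obtain ⟨v, hv⟩ := exists_dstar_eq hcl f.2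
      exact ⟨v, Subtype.ext hv⟩⟩
  norm_map' _ := rfl

theorem dstarEquiv_apply (hcl : IsClosed (rangeA0 Φ : Set (H0 Φ))) (v : VTilde Φ) :
    (dstarEquiv hcl v : H0 Φ) = dstar Φ v := rfl

theorem completeSpace (hcl : IsClosed (rangeA0 Φ : Set (H0 Φ))) : CompleteSpace (VTilde Φ) :=
  ((dstarEquiv hcl).isometry.isUniformInducing.completeSpace_congr
    (dstarEquiv hcl).surjective).2 inferInstance

end VTilde

open VTilde

/-! ### The variational isomorphism, its inverse on differentials, and `A₁` -/

theorem ATilde_apply_eq (v w : VTilde Φ) : ATilde Φ v w = pair0 Φ (dstar Φ v) (dstar Φ w) := rfl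

theorem dDual_apply_eq (g : H0 Φ) (w : VTilde Φ) : dDual Φ g w = pair0 Φ g (dstar Φ w) := rfl

theorem norm_ATilde (hcl : IsClosed (rangeA0 Φ : Set (H0 Φ))) (v : VTilde Φ) :
    ‖ATilde Φ v‖ = ‖v‖ := by
  refine le_antisymm (ContinuousLinearMap.opNorm_le_bound _ (norm_nonneg _) fun w => ?_) ?_
  · rw [ATilde_apply_eq, pair0_eq_inner]
    exact (norm_inner_le_norm _ _).trans_eq (by rw [norm_star_H0]; rfl)
  -- The norm is attained at the `w` for which `d₀* w` is the conjugate of `d₀* v`.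
  · obtain ⟨w, hw⟩ := exists_dstar_eq hcl (star_mem_constants_orthogonal Φ (dstar_mem v))
    have hn : ‖w‖ = ‖v‖ := by
      change ‖dstar Φ w‖ = ‖dstar Φ v‖
      rw [hw, norm_star_H0]
    have h := (ATilde Φ v).le_opNorm w
    rw [ATilde_apply_eq, hw, pair0_eq_inner, inner_self_eq_norm_sq_to_K, norm_star_H0, hn] at h
    have h2 : ‖v‖ ^ 2 ≤ ‖ATilde Φ v‖ * ‖v‖ := by
      have h1 : ‖dstar Φ v‖ = ‖v‖ := rfl
      simpa [h1] using h
    rcases (norm_nonneg v).eq_or_lt with h0 | h0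
    · rw [← h0]
      exact norm_nonneg _
    · nlinarith

theorem ATilde_injective (hcl : IsClosed (rangeA0 Φ : Set (H0 Φ))) :
    Function.Injective (ATilde Φ) := by
  rw [injective_iff_map_eq_zero]
  intro v hv
  have h := norm_ATilde hcl v
  rw [hv, norm_zero] at h
  apply dstar_injective
  rw [map_zero]
  exact norm_eq_zero.1 h.symm

theorem ATilde_surjective (hcl : IsClosed (rangeA0 Φ : Set (H0 Φ))) :
    Function.Surjective (ATilde Φ) := by
  intro l
  let l' : StrongDual ℂ (constants Φ)ᗮ :=
    l.comp ((dstarEquiv hcl).symm.toContinuousLinearEquiv : (constants Φ)ᗮ →L[ℂ] VTilde Φ)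
  -- Riesz represents the functional on `ℂ^⊥` by `k`; since the form is bilinear, the preimage `v`
  -- must satisfy `d₀* v = k̄`.
  let k := (InnerProductSpace.toDual ℂ (constants Φ)ᗮ).symm l'
  obtain ⟨v, hv⟩ := exists_dstar_eq hcl (star_mem_constants_orthogonal Φ k.2)
  refine ⟨v, ContinuousLinearMap.ext fun w => ?_⟩
  rw [ATilde_apply_eq, hv, pair0_eq_inner, star_star, ← dstarEquiv_apply hcl,
    ← Submodule.coe_inner, InnerProductSpace.toDual_symm_apply]
  simp [l']

/-- The isomorphism `Ã : Ṽ → Ṽ'`. -/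
noncomputable def ATildeEquiv (hcl : IsClosed (rangeA0 Φ : Set (H0 Φ))) :
    VTilde Φ ≃ₗᵢ[ℂ] StrongDual ℂ (VTilde Φ) where
  toLinearEquiv := LinearEquiv.ofBijective (ATilde Φ : VTilde Φ →ₗ[ℂ] StrongDual ℂ (VTilde Φ))
    ⟨ATilde_injective hcl, ATilde_surjective hcl⟩
  norm_map' := norm_ATilde hcl

/-- Both functionals are pairings against the range of `d₀*`, which is blind to constants. The
converse follows from solvability of `d₀* v = P g` and injectivity of `Ã`. -/
theorem ATilde_eq_dDual_iff (hcl : IsClosed (rangeA0 Φ : Set (H0 Φ))) {v : VTilde Φ} {g : H0 Φ} :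
    ATilde Φ v = dDual Φ g ↔ dstar Φ v = P Φ g := by
  have h : ∀ {v : VTilde Φ}, dstar Φ v = P Φ g → ATilde Φ v = dDual Φ g := fun {v} hv =>
    ContinuousLinearMap.ext fun w => by
      rw [ATilde_apply_eq, dDual_apply_eq, hv, pair0_P Φ (dstar_mem w)]
  refine ⟨fun hv => ?_, h⟩
  obtain ⟨v', hv'⟩ := exists_dstar_eq hcl (P_mem_constants_orthogonal Φ g)
  rw [ATilde_injective hcl (hv.trans (h hv').symm), hv']

theorem dDual_domain_apply (g : (d0 Φ).domain) (w : VTilde Φ) :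
    dDual Φ g w = pair1 Φ (d0 Φ g) (toH1 Φ w) :=
  pair0_adjoint Φ g _

theorem mem_graph_A1_iff (v : VTilde Φ) {f : H1 Φ} :
    (toH1 Φ v, f) ∈ (A1 Φ).graph ↔ (dstar Φ v, f) ∈ (d0 Φ).graph := by
  rw [mem_graph_A1_of_mem_X1 Φ (toH1_mem_X1 v)]
  simp only [mem_graph_adjoint_iff, exists_eq_left]

theorem ATilde_eq_pair1_iff (v : VTilde Φ) {f : H1 Φ} (hf : f ∈ X1 Φ) :
    (∀ w, ATilde Φ v w = pair1 Φ f (toH1 Φ w)) ↔ (toH1 Φ v, f) ∈ (A1 Φ).graph := by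
  rw [mem_graph_A1_iff]
  constructor
  · intro h
    -- The hypothesis only tests forms in `X`, while the second adjoint needs every `y ∈ D(d₀*)`.
    -- Projecting `y` to `X` changes neither `d₀* y` nor its product with `f̄ ∈ X`.
    have hg : (star (dstar Φ v), conjForm Φ f) ∈ (d0 Φ).graph := by
      refine LinearPMap.mem_graph_of_adjoint_pairing (isClosed_d0 Φ) (dense_domain_d0 Φ) fun y => ?_
      obtain ⟨hy, hy'⟩ := LinearPMap.exists_adjoint_starProjection (dense_domain_d0 Φ) y
      obtain ⟨w, hw, hw'⟩ := exists_of_mem (y := ⟨_, hy⟩)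
        (Submodule.starProjection_apply_mem _ _)
      have h1 := h w
      rw [ATilde_apply_eq, pair0_eq_inner, pair1_eq_inner, hw, hw', hy'] at h1
      have h2 := (X1 Φ).starProjection_inner_eq_zero (y : H1 Φ) _ (conjForm_mem_X1 Φ hf)
      rw [inner_sub_left, sub_eq_zero] at h2
      rw [h2, ← inner_conj_symm, h1, inner_conj_symm]
      rfl
    rw [d0_graph] at hg ⊢
    have := star_mem_graphD0 Φ hg
    rwa [star_star, conjForm_conjForm] at this
  · intro h w
    obtain ⟨u, hu, rfl⟩ := (LinearPMap.mem_graph_iff _).1 h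
    rw [ATilde_apply_eq, ← show (u : H0 Φ) = dstar Φ v from hu]
    exact pair0_adjoint Φ u _

/-- `Ã⁻¹ d₀ g` is the unique solution of `A₁ v = d₀ g` in `X`. -/
theorem mem_graph_A1_d0_iff (hcl : IsClosed (rangeA0 Φ : Set (H0 Φ))) (g : (d0 Φ).domain)
    {v : H1 Φ} (hv : v ∈ X1 Φ) :
    (v, d0 Φ g) ∈ (A1 Φ).graph ↔ v = toH1 Φ ((ATildeEquiv hcl).symm (dDual Φ g)) := by
  have hX : d0 Φ g ∈ X1 Φ := Submodule.le_topologicalClosure _ ⟨g, rfl⟩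
  have key : ∀ w : VTilde Φ, (toH1 Φ w, d0 Φ g) ∈ (A1 Φ).graph ↔
      w = (ATildeEquiv hcl).symm (dDual Φ g) := by
    intro w
    rw [← ATilde_eq_pair1_iff w hX, LinearIsometryEquiv.eq_symm_apply]
    simp only [← dDual_domain_apply]
    exact ⟨fun h => ContinuousLinearMap.ext h, fun h x => DFunLike.congr_fun h x⟩
  constructor
  · intro h
    -- Any solution in `X` lies in `D(d₀*)`, hence comes from `Ṽ`, where `key` applies.
    obtain ⟨u, hu, -⟩ := (mem_graph_A1_of_mem_X1 Φ hv).1 h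
    obtain ⟨w, hw, -⟩ := exists_of_mem (y := ⟨v, LinearPMap.mem_domain_of_mem_graph hu⟩) hv
    obtain rfl : toH1 Φ w = v := hw
    rw [← (key w).1 h]
  · intro h
    rw [h]
    exact (key _).2 rfl

/-- For a test form `φ`, the form `exp Φ • φ` is in the domain of `d₀*`, and its projection to `X`
represents the action of the distribution `d g` on `φ`. -/
theorem exists_dDual_eq_distD (g : H0 Φ) {φ : E n → EuclideanSpace ℂ (Fin n)} (hφ : IsTest φ) :
    ∃ (w : H1 Φ) (v : VTilde Φ),
      w =ᵐ[Φ.gibbs] (fun x => (Real.exp (Φ.toFun x) : ℂ) • φ x) ∧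
      toH1 Φ v = (X1 Φ).starProjection w ∧
      dDual Φ g v = ∑ j, distD g j (fun x => φ x j) := by
  have hφj : ∀ j, IsTest fun x => φ x j := fun j =>
    ⟨(contDiff_piLp 2).1 hφ.1 j, hφ.2.comp_left (g := fun z : EuclideanSpace ℂ (Fin n) => z j) rfl⟩
  -- Minus the divergence of `φ`, chosen because `d₀* (exp Φ • φ) = exp Φ • ψ`.
  let ψ : E n → ℂ := fun x => -∑ j, partialD j (fun x => φ x j) x
  have hψ : Continuous ψ :=
    (continuous_finsetSum _ fun j _ => ((hφj j).partialD j).1.continuous).neg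
  have hψc : HasCompactSupport ψ := by
    refine hφ.2.mono' fun x hx => ?_
    by_contra hxs
    refine hx ?_
    have h0 : φ =ᶠ[nhds x] 0 := notMem_tsupport_iff_eventuallyEq.1 hxs
    have : ∀ j, partialD j (fun x => φ x j) x = 0 := fun j => by
      have : (fun x => φ x j) =ᶠ[nhds x] fun _ => 0 := h0.mono fun y hy => by simp [hy]
      rw [partialD, this.fderiv_eq]
      simp
    simp [ψ, this]
  have hint : ∀ u : H0 Φ, ∑ j, distD u j (fun x => φ x j) = ∫ x, u x * ψ x := by
    intro u
    simp only [distD, ψ, mul_neg, Finset.mul_sum, integral_neg, Finset.sum_neg_distrib]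
    rw [integral_finsetSum _ fun j _ =>
      integrable_mul_test (locallyIntegrable_of_Lp Φ u) ((hφj j).partialD j)]
  set w : H1 Φ := (memLp_exp_smul Φ hφ.1.continuous hφ.2).toLp _ with hw
  set z : H0 Φ := (memLp_exp_smul Φ hψ hψc).toLp _ with hz
  -- The integration by parts is the definition of `d₀ u`, tested on the conjugates of the
  -- components of `φ`.
  have hadj : ∀ u : (d0 Φ).domain, inner ℂ z (u : H0 Φ) = inner ℂ w (d0 Φ u) := by
    intro u
    have hu : ((u : H0 Φ), d0 Φ u) ∈ graphD0 Φ := d0_graph Φ ▸ (d0 Φ).mem_graph u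
    rw [hz, hw, inner_exp_smul Φ hψ hψc, inner_exp_smul Φ hφ.1.continuous hφ.2]
    have h1 : ∀ x, inner ℂ (φ x) (d0 Φ u x) = ∑ j, d0 Φ u x j * star (φ x j) := fun x => by
      rw [PiLp.inner_apply]
      exact Finset.sum_congr rfl fun j _ => by simp
    simp only [h1]
    rw [integral_finsetSum _ fun j _ =>
      integrable_mul_test (locallyIntegrable_coord _ j) (hφj j).conj]
    have h2 : ∀ j, ∫ x, d0 Φ u x j * star (φ x j) = distD u j fun x => star (φ x j) :=
      fun j => hu j _ (hφj j).conj
    simp only [h2, distD, partialD_star (hφj _)]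
    rw [Finset.sum_neg_distrib, ← integral_finsetSum _ fun j _ =>
      integrable_mul_test (locallyIntegrable_of_Lp Φ (u : H0 Φ)) ((hφj j).partialD j).conj, ← integral_neg]
    refine integral_congr_ae (Filter.Eventually.of_forall fun x => ?_)
    simp [ψ, Finset.mul_sum]
  have hwd : w ∈ (d0 Φ)†.domain := LinearPMap.mem_adjoint_domain_of_exists _ ⟨z, hadj⟩
  have hwz : (d0 Φ)† ⟨w, hwd⟩ = z :=
    LinearPMap.adjoint_apply_eq (dense_domain_d0 Φ) ⟨w, hwd⟩ hadj
  obtain ⟨hy, hy'⟩ := LinearPMap.exists_adjoint_starProjection (dense_domain_d0 Φ)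
    (⟨w, hwd⟩ : (d0 Φ)†.domain)
  obtain ⟨v, hv, hv'⟩ := exists_of_mem (y := ⟨_, hy⟩) (Submodule.starProjection_apply_mem _ _)
  refine ⟨w, v, (memLp_exp_smul Φ hφ.1.continuous hφ.2).coeFn_toLp, hv, ?_⟩
  rw [dDual_apply_eq, hv', hy', hwz, hint, pair0_apply]
  have h3 : (fun x => g x * z x) =ᵐ[Φ.gibbs] fun x => g x * ((Real.exp (Φ.toFun x) : ℂ) • ψ x) :=
    (memLp_exp_smul Φ hψ hψc).coeFn_toLp.mono fun x hx => by
      dsimp only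
      rw [hz, hx]
  rw [integral_congr_ae h3, integral_gibbs]
  refine integral_congr_ae (Filter.Eventually.of_forall fun x => ?_)
  have h4 : (Real.exp (-Φ.toFun x) : ℂ) * (Real.exp (Φ.toFun x) : ℂ) = 1 := by
    rw [← Complex.ofReal_mul, ← Real.exp_add]
    simp
  simp only [smul_eq_mul]
  linear_combination (g x * ψ x) * h4

end WeightedComplex

theorem theorem1p2 (n : ℕ) (Φ : Potential n) (hcl : IsClosed (rangeA0 Φ : Set (H0 Φ))) :
    -- `Ṽ` is a Hilbert space, and `Ã` is an isomorphism `e` of it onto its dual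
    CompleteSpace (VTilde Φ) ∧
    ∃ e : VTilde Φ ≃L[ℂ] StrongDual ℂ (VTilde Φ),
      (∀ v, e v = ATilde Φ v) ∧
      -- the part of `Ã` in `X` is `A₁` restricted to `X`
      (∀ (v : VTilde Φ), ∀ f ∈ X1 Φ,
        (∀ w, e v w = pair1 Φ f (VTilde.toH1 Φ w)) ↔ (VTilde.toH1 Φ v, f) ∈ (A1 Φ).graph) ∧
      -- `d : L²(μ) → Ṽ'` extends `d₀`
      (∀ (g : (d0 Φ).domain) (w : VTilde Φ),
        dDual Φ g w = pair1 Φ (d0 Φ g) (VTilde.toH1 Φ w)) ∧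
      -- `d : L²(μ) → Ṽ'` is the distributional differential, where `Ṽ'` acts on a test form `φ`
      -- through the projection of `exp Φ • φ` to `X`
      (∀ (g : H0 Φ) (φ : E n → EuclideanSpace ℂ (Fin n)), IsTest φ →
        ∃ (w : H1 Φ) (v : VTilde Φ),
          w =ᵐ[Φ.gibbs] (fun x => (Real.exp (Φ.toFun x) : ℂ) • φ x) ∧
          VTilde.toH1 Φ v = (X1 Φ).starProjection w ∧
          dDual Φ g v = ∑ j, distD g j (fun x => φ x j)) ∧
      -- for `g₁ ∈ H¹(μ)`, `Ã⁻¹ d g₁` is the unique `v ∈ D(A₁) ∩ X` with `A₁ v = d₀ g₁`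
      (∀ (g₁ : (d0 Φ).domain), ∀ v ∈ X1 Φ,
        (v, d0 Φ g₁) ∈ (A1 Φ).graph ↔ v = VTilde.toH1 Φ (e.symm (dDual Φ g₁))) ∧
      -- the covariance identity for all `g₁`, `g₂` in `L²(μ)`, with the right-hand side as a duality
      (∀ g₁ g₂ : H0 Φ,
        inner ℂ (P Φ g₂) (P Φ g₁) = dDual Φ (star g₂) (e.symm (dDual Φ g₁))) ∧
      -- for `g₂ ∈ H¹(μ)` the duality is the inner product of 1-forms
      (∀ (g₁ : H0 Φ) (g₂ : (d0 Φ).domain),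
        inner ℂ (P Φ g₂) (P Φ g₁) =
          inner ℂ (d0 Φ g₂) (VTilde.toH1 Φ (e.symm (dDual Φ g₁)))) ∧
      -- `L²(μ) = R(A₀) ⊕ ℂ`, an orthogonal sum
      IsCompl (rangeA0 Φ) (constants Φ) ∧ (rangeA0 Φ) ⟂ (constants Φ) ∧
      -- `P` is the orthogonal projection onto `L²(μ) ⊖ ℂ`, and `P u = d₀* Ã⁻¹ d u`
      (∀ u : H0 Φ, P Φ u = (constants Φ)ᗮ.starProjection u) ∧
      (∀ u : H0 Φ, P Φ u = VTilde.dstar Φ (e.symm (dDual Φ u))) := by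
  have hinv : ∀ g : H0 Φ, VTilde.dstar Φ ((ATildeEquiv hcl).symm (dDual Φ g)) = P Φ g := fun g =>
    (ATilde_eq_dDual_iff hcl).1 ((ATildeEquiv hcl).apply_symm_apply (dDual Φ g))
  refine ⟨VTilde.completeSpace hcl, (ATildeEquiv hcl).toContinuousLinearEquiv, fun _ => rfl,
    fun v f hf => ATilde_eq_pair1_iff v hf, dDual_domain_apply,
    fun g φ hφ => exists_dDual_eq_distD g hφ, fun g v hv => mem_graph_A1_d0_iff hcl g hv,
    fun g₁ g₂ => ?_, fun g₁ g₂ => ?_, ?_, ?_, P_eq_starProjection Φ, fun u => (hinv u).symm⟩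
  · refine Eq.trans ?_ (dDual_apply_eq (star g₂) ((ATildeEquiv hcl).symm (dDual Φ g₁))).symm
    -- The conjugate on `g₂` in the bilinear duality restores the sesquilinear product.
    rw [hinv, pair0_eq_inner, star_star, inner_P_P]
  · rw [inner_P_P, ← hinv g₁, VTilde.dstar_eq]
    exact ((LinearPMap.adjoint_isFormalAdjoint (dense_domain_d0 Φ)).symm g₂ ⟨_, _⟩).symm
  · rw [rangeA0_eq hcl]
    have := finiteDimensional_constants Φ
    exact (constants Φ).isCompl_orthogonal.symm
  · rw [rangeA0_eq hcl]
    exact (constants Φ).isOrtho_orthogonal_left
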